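/- Let $n\ge 1$, let $\mathbf X$ be any random vector in $\mathbb R^n$ (no moment or density assumption), and let $\mathbf Z\sim\mathcal N(\mathbf 0,\mathbf I_n)$ be independent of $\mathbf X$. For $\mathsf{snr}>0$ let $\mathbf Y_{\mathsf{snr}}=\sqrt{\mathsf{snr}}\,\mathbf X+\mathbf Z$. For $p\ge 0$ define the minimum mean $p$-th error $$\mathrm{mmpe}(\mathbf X,\mathsf{snr},p)=\inf_{f}\ \frac1n\,\mathbb E\Big[\mathsf{Err}^{\frac p2}\big(\mathbf X,f(\mathbf Y_{\mathsf{snr}})\big)\Big],\qquad \mathsf{Err}(\mathbf x,\mathbf v)=\mathrm{Tr}\big((\mathbf x-\mathbf v)(\mathbf x-\mathbf v)^{T}\big)=\|\mathbf x-\mathbf v\|^2,$$ where the infimum is over all Borel measurable functions $f:\mathbb R^n\to\mathbb R^n$ (and $0^0=1$ when $p=0$). Proposition. For fixed $\mathbf X$ and $p$, $\mathrm{mmpe}(\mathbf X,\mathsf{snr},p)$ is finite for every $\mathsf{snr}>0$, and $\mathsf{snr}\mapsto\mathrm{mmpe}(\mathbf X,\mathsf{snr},p)$ is a continuous real-valued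 function on $(0,\infty)$. -/

import Mathlib

open MeasureTheory ProbabilityTheory Set
open scoped ENNReal

noncomputable section

/-- The squared error `Err(x, v) = Tr((x - v)(x - v)ᵀ)` of two vectors of `ℝⁿ`. -/
def sqErr {n : ℕ} (x v : EuclideanSpace ℝ (Fin n)) : ℝ :=
  (Matrix.vecMulVec (x - v).ofLp (x - v).ofLp).trace

theorem sqErr_eq_norm_sq {n : ℕ} (x v : EuclideanSpace ℝ (Fin n)) :
    sqErr x v = ‖x - v‖ ^ 2 := by
  rw [sqErr, EuclideanSpace.norm_sq_eq]
  simp [Matrix.trace, Matrix.vecMulVec_apply, sq]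

/-- The `p`-th error `n⁻¹ 𝔼[Err^{p/2}(X, V)]` of estimating the random vector `X` by `V`,
as an extended nonnegative number (the integrand is nonnegative). -/
def pthError {Ω : Type*} [MeasurableSpace Ω] {n : ℕ} (P : Measure Ω)
    (X V : Ω → EuclideanSpace ℝ (Fin n)) (p : ℝ) : ℝ≥0∞ :=
  (n : ℝ≥0∞)⁻¹ * ∫⁻ ω, ENNReal.ofReal (sqErr (X ω) (V ω) ^ (p / 2)) ∂P

/-- The minimum mean `p`-th error of estimating `X` from `Y`: the infimum of the `p`-th error
over all estimators `f(Y)` with `f` Borel measurable. -/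
def mmpe {Ω : Type*} [MeasurableSpace Ω] {n : ℕ} (P : Measure Ω)
    (X Y : Ω → EuclideanSpace ℝ (Fin n)) (p : ℝ) : ℝ≥0∞ :=
  ⨅ (f : EuclideanSpace ℝ (Fin n) → EuclideanSpace ℝ (Fin n)) (_ : Measurable f),
    pthError P X (fun ω => f (Y ω)) p

/-- The output `Y = √snr X + Z` of the additive noise channel. -/
def channelOutput {Ω : Type*} {n : ℕ} (X Z : Ω → EuclideanSpace ℝ (Fin n)) (snr : ℝ) :
    Ω → EuclideanSpace ℝ (Fin n) :=
  fun ω => √snr • X ω + Z ω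

end

/-!
Rescaling the channel output turns it into `X + N` with `N` Gaussian of density `φ_s`, where `s` is
the signal-to-noise ratio. By Tonelli and a measurable selection, the infimum over estimators
becomes `∫ dy inf_v ∫ φ_s(y - x) ‖x - v‖ᵖ μ(dx)`, where `μ` is the law of `X`. The distance from
`y` of a near-optimal `v` is controlled by the mass and the moment about `y` of the measure
`φ_s(y - x) μ(dx)`, so each inner infimum is continuous in `s`. The choice `v = y` bounds it by
`∫ φ_s(y - x) ‖y - x‖ᵖ μ(dx)`. For `s` near `s₀`, `φ_s` is at most a multiple of a wider Gaussian
density, all of whose moments are finite; dominated convergence in `y` then gives continuity.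
-/

open Filter Topology
open scoped NNReal

section WithDensity

variable {α ι : Type*} [MeasurableSpace α] {μ : Measure α} [TopologicalSpace ι]
  [FirstCountableTopology ι] {i₀ : ι} {φ : ι → α → ℝ≥0} {Φ : α → ℝ≥0}

lemma withDensity_le_add_withDensity_nndist (μ : Measure α) (φ : α → ℝ≥0) {ψ : α → ℝ≥0}
    (hψ : Measurable ψ) :
    μ.withDensity (fun x => φ x) ≤
      μ.withDensity (fun x => ψ x) + μ.withDensity (fun x => nndist (φ x) (ψ x)) := by
  rw [← withDensity_add_left (by fun_prop)]
  refine withDensity_mono (.of_forall fun x => ?_)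
  change (φ x : ℝ≥0∞) ≤ ψ x + nndist (φ x) (ψ x)
  exact_mod_cast NNReal.le_add_nndist (φ x) (ψ x)

lemma continuousAt_lintegral_withDensity (hφm : ∀ i, Measurable (φ i))
    (hφc : ∀ x, ContinuousAt (φ · x) i₀) (hφΦ : ∀ᶠ i in 𝓝 i₀, ∀ x, φ i x ≤ Φ x)
    {h : α → ℝ≥0∞} (hm : Measurable h) (h_top : ∀ x, h x ≠ ∞)
    (hΦ : ∫⁻ x, Φ x * h x ∂μ ≠ ∞) :
    ContinuousAt (fun i => ∫⁻ x, h x ∂μ.withDensity fun x => φ i x) i₀ := by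
  have hdens (i : ι) : ∫⁻ x, h x ∂μ.withDensity (fun x => φ i x) = ∫⁻ x, φ i x * h x ∂μ :=
    lintegral_withDensity_eq_lintegral_mul _ (hφm i).coe_nnreal_ennreal hm
  simp only [ContinuousAt, hdens]
  refine tendsto_lintegral_filter_of_dominated_convergence (fun x => Φ x * h x)
    (.of_forall fun i => by fun_prop) ?_ hΦ (.of_forall fun x => ?_)
  · filter_upwards [hφΦ] with i hi
    refine .of_forall fun x => ?_
    gcongr
    exact hi x
  · exact ENNReal.Tendsto.mul_const (ENNReal.tendsto_coe.2 (hφc x)) (.inr (h_top x))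

lemma tendsto_lintegral_withDensity_nndist (hφm : ∀ i, Measurable (φ i))
    (hφc : ∀ x, ContinuousAt (φ · x) i₀) (hφΦ : ∀ᶠ i in 𝓝 i₀, ∀ x, φ i x ≤ Φ x)
    {h : α → ℝ≥0∞} (hm : Measurable h) (h_top : ∀ x, h x ≠ ∞)
    (hΦ : ∫⁻ x, Φ x * h x ∂μ ≠ ∞) :
    Tendsto (fun i => ∫⁻ x, h x ∂μ.withDensity fun x => nndist (φ i x) (φ i₀ x))
      (𝓝 i₀) (𝓝 0) := by
  have hbound : ∀ᶠ i in 𝓝 i₀, ∀ x, nndist (φ i x) (φ i₀ x) ≤ Φ x := by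
    filter_upwards [hφΦ] with i hi x
    rw [NNReal.nndist_eq]
    exact max_le (tsub_le_self.trans (hi x)) (tsub_le_self.trans (hφΦ.self_of_nhds x))
  simpa [ContinuousAt] using continuousAt_lintegral_withDensity
    (fun i => (hφm i).nndist (hφm i₀)) (fun x => (hφc x).nndist continuousAt_const) hbound
    hm h_top hΦ

end WithDensity

lemma tendsto_of_le_add_of_le_add {ι : Type*} {l : Filter ι} {a d e : ι → ℝ≥0∞} {a₀ : ℝ≥0∞}
    (hle : ∀ᶠ i in l, a i ≤ a₀ + d i) (hge : ∀ᶠ i in l, a₀ ≤ a i + e i)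
    (hd : Tendsto d l (𝓝 0)) (he : Tendsto e l (𝓝 0)) : Tendsto a l (𝓝 a₀) := by
  have hupper : Tendsto (fun i => a₀ + d i) l (𝓝 a₀) := by
    simpa using tendsto_const_nhds.add hd
  have hlower : Tendsto (fun i => a₀ - e i) l (𝓝 a₀) := by
    simpa using ENNReal.Tendsto.sub tendsto_const_nhds he (.inr ENNReal.zero_ne_top)
  refine tendsto_of_tendsto_of_tendsto_of_le_of_le' hlower hupper ?_ hle
  filter_upwards [hge] with i hi using tsub_le_iff_right.2 hi

section MinDeviation

variable {E : Type*} [NormedAddCommGroup E] {p : ℝ}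

lemma enorm_sub_rpow_le_two_rpow_mul (hp : 0 ≤ p) (x y z : E) :
    ‖x - z‖ₑ ^ p ≤ 2 ^ p * (‖x - y‖ₑ ^ p + ‖y - z‖ₑ ^ p) :=
  calc ‖x - z‖ₑ ^ p ≤ (‖x - y‖ₑ + ‖y - z‖ₑ) ^ p := by
        gcongr
        simpa using enorm_add_le (x - y) (y - z)
    _ ≤ 2 ^ p * (‖x - y‖ₑ ^ p + ‖y - z‖ₑ ^ p) :=
        ENNReal.add_rpow_le_two_rpow_mul_rpow_add_rpow _ _ hp

variable [MeasurableSpace E]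

/-- The least `p`-th moment of a measure about a point: the error of the best constant estimator
of a random vector with (unnormalised) law `ρ`. -/
noncomputable def minDeviation (p : ℝ) (ρ : Measure E) : ℝ≥0∞ :=
  ⨅ v : E, ∫⁻ x, ‖x - v‖ₑ ^ p ∂ρ

lemma minDeviation_le (p : ℝ) (ρ : Measure E) (v : E) :
    minDeviation p ρ ≤ ∫⁻ x, ‖x - v‖ₑ ^ p ∂ρ :=
  iInf_le _ v

lemma lintegral_enorm_sub_rpow_le (hp : 0 ≤ p) (ρ : Measure E) (c v : E) :
    ∫⁻ x, ‖x - v‖ₑ ^ p ∂ρ ≤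
      2 ^ p * (∫⁻ x, ‖x - c‖ₑ ^ p ∂ρ + ‖c - v‖ₑ ^ p * ρ univ) :=
  calc ∫⁻ x, ‖x - v‖ₑ ^ p ∂ρ ≤ ∫⁻ x, 2 ^ p * (‖x - c‖ₑ ^ p + ‖c - v‖ₑ ^ p) ∂ρ :=
        lintegral_mono fun x => enorm_sub_rpow_le_two_rpow_mul hp x c v
    _ = 2 ^ p * (∫⁻ x, ‖x - c‖ₑ ^ p ∂ρ + ‖c - v‖ₑ ^ p * ρ univ) := by
        rw [lintegral_const_mul' _ _ (by finiteness), lintegral_add_right _ measurable_const,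
          lintegral_const]

/-- The bound on the change of `minDeviation p ρ` when the mass of `ρ` increases by at most `η`,
in terms of `p`-th moments about a reference point `c`. -/
noncomputable def deviationError (p : ℝ) (c : E) (ρ η : Measure E) : ℝ≥0∞ :=
  2 ^ p * (∫⁻ x, ‖x - c‖ₑ ^ p ∂η +
    2 ^ p * (2 * ∫⁻ x, ‖x - c‖ₑ ^ p ∂ρ) / ρ univ * η univ)

lemma tendsto_deviationError {ι : Type*} {l : Filter ι} {ρ η : ι → Measure E} {c : E}
    {a m : ℝ≥0∞} (ha : a ≠ 0) (hm : m ≠ ∞)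
    (hρ : Tendsto (fun i => ρ i univ) l (𝓝 a))
    (hρc : Tendsto (fun i => ∫⁻ x, ‖x - c‖ₑ ^ p ∂ρ i) l (𝓝 m))
    (hη : Tendsto (fun i => η i univ) l (𝓝 0))
    (hηc : Tendsto (fun i => ∫⁻ x, ‖x - c‖ₑ ^ p ∂η i) l (𝓝 0)) :
    Tendsto (fun i => deviationError p c (ρ i) (η i)) l (𝓝 0) := by
  have hp2 : (2 : ℝ≥0∞) ^ p ≠ ∞ := by finiteness
  have hquot : Tendsto (fun i => 2 ^ p * (2 * ∫⁻ x, ‖x - c‖ₑ ^ p ∂ρ i) / ρ i univ) l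
      (𝓝 (2 ^ p * (2 * m) / a)) :=
    ENNReal.Tendsto.div (ENNReal.Tendsto.const_mul
      (ENNReal.Tendsto.const_mul hρc (.inr (by finiteness))) (.inr hp2))
      (.inr ha) hρ (.inr (by finiteness))
  have hquot_ne_top : 2 ^ p * (2 * m) / a ≠ ∞ := by finiteness
  simpa [deviationError] using ENNReal.Tendsto.const_mul
    (hηc.add (ENNReal.Tendsto.mul hquot (.inr ENNReal.zero_ne_top) hη (.inr hquot_ne_top)))
    (.inr hp2)

variable [BorelSpace E]

lemma enorm_sub_rpow_mul_measure_univ_le (hp : 0 ≤ p) (ρ : Measure E) (c v : E) :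
    ‖c - v‖ₑ ^ p * ρ univ ≤
      2 ^ p * (∫⁻ x, ‖x - c‖ₑ ^ p ∂ρ + ∫⁻ x, ‖x - v‖ₑ ^ p ∂ρ) :=
  calc ‖c - v‖ₑ ^ p * ρ univ = ∫⁻ _, ‖c - v‖ₑ ^ p ∂ρ := (lintegral_const _).symm
    _ ≤ ∫⁻ x, 2 ^ p * (‖x - c‖ₑ ^ p + ‖x - v‖ₑ ^ p) ∂ρ := lintegral_mono fun x => by
        simpa only [enorm_sub_rev c x] using enorm_sub_rpow_le_two_rpow_mul hp c x v
    _ = 2 ^ p * (∫⁻ x, ‖x - c‖ₑ ^ p ∂ρ + ∫⁻ x, ‖x - v‖ₑ ^ p ∂ρ) := by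
        rw [lintegral_const_mul' _ _ (by finiteness), lintegral_add_left (by fun_prop)]

lemma minDeviation_le_add_deviationError (hp : 0 ≤ p) {ρ ρ' η : Measure E} [IsFiniteMeasure ρ]
    [NeZero ρ] (h : ρ' ≤ ρ + η) (c : E) :
    minDeviation p ρ' ≤ minDeviation p ρ + deviationError p c ρ η := by
  -- A point `v` doing no worse than `c` is not far from `c`, so `η` can be integrated against it.
  have of_le (v : E) (hv : ∫⁻ x, ‖x - v‖ₑ ^ p ∂ρ ≤ ∫⁻ x, ‖x - c‖ₑ ^ p ∂ρ) :
      minDeviation p ρ' ≤ ∫⁻ x, ‖x - v‖ₑ ^ p ∂ρ + deviationError p c ρ η := by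
    have hdist : ‖c - v‖ₑ ^ p ≤ 2 ^ p * (2 * ∫⁻ x, ‖x - c‖ₑ ^ p ∂ρ) / ρ univ := by
      rw [ENNReal.le_div_iff_mul_le (.inl (NeZero.ne _)) (.inl (measure_ne_top _ _)), two_mul]
      exact (enorm_sub_rpow_mul_measure_univ_le hp ρ c v).trans (by gcongr)
    calc minDeviation p ρ' ≤ ∫⁻ x, ‖x - v‖ₑ ^ p ∂ρ' := minDeviation_le p ρ' v
      _ ≤ ∫⁻ x, ‖x - v‖ₑ ^ p ∂(ρ + η) := lintegral_mono' h le_rfl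
      _ = ∫⁻ x, ‖x - v‖ₑ ^ p ∂ρ + ∫⁻ x, ‖x - v‖ₑ ^ p ∂η := lintegral_add_measure _ _ _
      _ ≤ ∫⁻ x, ‖x - v‖ₑ ^ p ∂ρ + deviationError p c ρ η := by
        gcongr
        exact (lintegral_enorm_sub_rpow_le hp η c v).trans (by unfold deviationError; gcongr)
  rw [minDeviation.eq_def p ρ, ENNReal.iInf_add]
  refine le_iInf fun v => ?_
  obtain hv | hv := le_total (∫⁻ x, ‖x - v‖ₑ ^ p ∂ρ) (∫⁻ x, ‖x - c‖ₑ ^ p ∂ρ)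
  · exact of_le v hv
  · exact (of_le c le_rfl).trans (by gcongr)

lemma continuous_lintegral_enorm_sub_rpow (hp : 0 ≤ p) {ρ : Measure E} [IsFiniteMeasure ρ] {c : E}
    (hc : ∫⁻ x, ‖x - c‖ₑ ^ p ∂ρ ≠ ∞) :
    Continuous fun v => ∫⁻ x, ‖x - v‖ₑ ^ p ∂ρ := by
  refine continuous_iff_continuousAt.2 fun v₀ => ?_
  have hnear : ∀ᶠ v in 𝓝 v₀, ‖c - v‖ₑ ^ p < ‖c - v₀‖ₑ ^ p + 1 :=
    Tendsto.eventually_lt_const (ENNReal.lt_add_right (by finiteness) one_ne_zero)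
      (Continuous.tendsto (by fun_prop) v₀)
  refine tendsto_lintegral_filter_of_dominated_convergence
    (fun x => 2 ^ p * (‖x - c‖ₑ ^ p + (‖c - v₀‖ₑ ^ p + 1))) (.of_forall fun v => by fun_prop)
    ?_ ?_ (.of_forall fun x => Continuous.tendsto (by fun_prop) v₀)
  · filter_upwards [hnear] with v hv
    refine .of_forall fun x => (enorm_sub_rpow_le_two_rpow_mul hp x c v).trans ?_
    gcongr
  · rw [lintegral_const_mul' _ _ (by finiteness), lintegral_add_right _ measurable_const,
      lintegral_const]
    finiteness

lemma tendsto_minDeviation (hp : 0 ≤ p) {ι : Type*} {l : Filter ι} {ρ η : ι → Measure E}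
    {ρ₀ : Measure E} [IsFiniteMeasure ρ₀] {c : E}
    (hρc : ∫⁻ x, ‖x - c‖ₑ ^ p ∂ρ₀ ≠ ∞) (hle : ∀ᶠ i in l, ρ i ≤ ρ₀ + η i)
    (hge : ∀ᶠ i in l, ρ₀ ≤ ρ i + η i) (hη : Tendsto (fun i => η i univ) l (𝓝 0))
    (hηc : Tendsto (fun i => ∫⁻ x, ‖x - c‖ₑ ^ p ∂η i) l (𝓝 0)) :
    Tendsto (fun i => minDeviation p (ρ i)) l (𝓝 (minDeviation p ρ₀)) := by
  have hmass : Tendsto (fun i => ρ i univ) l (𝓝 (ρ₀ univ)) :=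
    tendsto_of_le_add_of_le_add (hle.mono fun i hi => hi univ) (hge.mono fun i hi => hi univ) hη hη
  have hmoment : Tendsto (fun i => ∫⁻ x, ‖x - c‖ₑ ^ p ∂ρ i) l (𝓝 (∫⁻ x, ‖x - c‖ₑ ^ p ∂ρ₀)) := by
    refine tendsto_of_le_add_of_le_add ?_ ?_ hηc hηc
    · filter_upwards [hle] with i hi
      exact (lintegral_mono' hi le_rfl).trans_eq (lintegral_add_measure _ _ _)
    · filter_upwards [hge] with i hi
      exact (lintegral_mono' hi le_rfl).trans_eq (lintegral_add_measure _ _ _)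
  obtain rfl | hρ₀ := eq_or_ne ρ₀ 0
  · have hzero : minDeviation p (0 : Measure E) = 0 :=
      le_antisymm ((minDeviation_le p _ c).trans_eq (lintegral_zero_measure _)) zero_le
    rw [hzero]
    rw [lintegral_zero_measure] at hmoment
    exact tendsto_of_tendsto_of_tendsto_of_le_of_le tendsto_const_nhds hmoment
      (fun _ => zero_le) fun i => minDeviation_le p (ρ i) c
  have : NeZero ρ₀ := ⟨hρ₀⟩
  have hmass₀ : ρ₀ univ ≠ 0 := NeZero.ne _
  refine tendsto_of_le_add_of_le_add
    (hle.mono fun i hi => minDeviation_le_add_deviationError hp hi c) ?_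
    (tendsto_deviationError hmass₀ hρc tendsto_const_nhds tendsto_const_nhds hη hηc)
    (tendsto_deviationError hmass₀ hρc hmass hmoment hη hηc)
  filter_upwards [hge, hmass.eventually_ne hmass₀,
    hmass.eventually_lt_const (measure_lt_top ρ₀ univ)] with i hi hi_ne hi_lt
  have : IsFiniteMeasure (ρ i) := ⟨hi_lt⟩
  have : NeZero (ρ i) := ⟨fun h => hi_ne (by simp [h])⟩
  exact minDeviation_le_add_deviationError hp hi c

lemma continuousAt_minDeviation_withDensity (hp : 0 ≤ p) {ι : Type*} [TopologicalSpace ι]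
    [FirstCountableTopology ι] {i₀ : ι} {μ : Measure E} {φ : ι → E → ℝ≥0} {Φ : E → ℝ≥0} {c : E}
    (hφm : ∀ i, Measurable (φ i)) (hφc : ∀ x, ContinuousAt (φ · x) i₀)
    (hφΦ : ∀ᶠ i in 𝓝 i₀, ∀ x, φ i x ≤ Φ x) (hΦ : ∫⁻ x, Φ x ∂μ ≠ ∞)
    (hΦc : ∫⁻ x, Φ x * ‖x - c‖ₑ ^ p ∂μ ≠ ∞) :
    ContinuousAt (fun i => minDeviation p (μ.withDensity fun x => φ i x)) i₀ := by
  have hφΦ₀ : ∀ x, φ i₀ x ≤ Φ x := hφΦ.self_of_nhds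
  have : IsFiniteMeasure (μ.withDensity fun x => φ i₀ x) :=
    isFiniteMeasure_withDensity
      (ne_top_of_le_ne_top hΦ (lintegral_mono fun x => ENNReal.coe_le_coe.2 (hφΦ₀ x)))
  refine tendsto_minDeviation hp (c := c)
    (η := fun i => μ.withDensity fun x => nndist (φ i x) (φ i₀ x)) ?_
    (.of_forall fun i => withDensity_le_add_withDensity_nndist μ (φ i) (hφm i₀))
    (.of_forall fun i => ?_) ?_
    (tendsto_lintegral_withDensity_nndist hφm hφc hφΦ (by fun_prop) (by finiteness) hΦc)
  · rw [lintegral_withDensity_eq_lintegral_mul _ (hφm i₀).coe_nnreal_ennreal (by fun_prop)]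
    refine ne_top_of_le_ne_top hΦc (lintegral_mono fun x => ?_)
    exact mul_le_mul_left (ENNReal.coe_le_coe.2 (hφΦ₀ x)) _
  · simpa only [nndist_comm] using
      withDensity_le_add_withDensity_nndist μ (φ i₀) (hφm i)
  · simpa using tendsto_lintegral_withDensity_nndist (h := 1) hφm hφc hφΦ measurable_one
      (by simp) (by simpa using hΦ)

end MinDeviation

section Interchange

open TopologicalSpace (SeparableSpace denseSeq denseRange_denseSeq)

variable {α β : Type*} [MeasurableSpace β]

lemma exists_measurable_index_le_iInf_add {g : ℕ → β → ℝ≥0∞} {w : β → ℝ≥0∞}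
    (hg : ∀ n, Measurable (g n)) (hw : Measurable w) (hw_pos : ∀ y, 0 < w y) :
    ∃ k : β → ℕ, Measurable k ∧ ∀ y, g (k y) y ≤ (⨅ n, g n y) + w y := by
  classical
  have hex (y : β) : ∃ n, g n y ≤ (⨅ m, g m y) + w y := by
    obtain htop | hfin := eq_or_ne (⨅ m, g m y) ∞
    · exact ⟨0, by simp [htop]⟩
    · obtain ⟨n, hn⟩ := iInf_lt_iff.1 (ENNReal.lt_add_right hfin (hw_pos y).ne')
      exact ⟨n, hn.le⟩
  exact ⟨fun y => Nat.find (hex y),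
    measurable_find hex fun n => measurableSet_le (hg n) ((Measurable.iInf hg).add hw),
    fun y => Nat.find_spec (hex y)⟩

variable [TopologicalSpace α] [SeparableSpace α] [Nonempty α]

lemma iInf_denseSeq_eq_iInf {F : α → ℝ≥0∞} (hF : Continuous F) :
    ⨅ n, F (denseSeq α n) = ⨅ v, F v :=
  (iInf_range' F (denseSeq α)).symm.trans ((denseRange_denseSeq α).ciInf' hF)

lemma aemeasurable_iInf_of_continuous {ν : Measure β} {F : β → α → ℝ≥0∞}
    (hF : ∀ v, Measurable fun y => F y v) (hc : ∀ᵐ y ∂ν, Continuous (F y)) :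
    AEMeasurable (fun y => ⨅ v, F y v) ν :=
  ⟨fun y => ⨅ n, F y (denseSeq α n), .iInf fun n => hF (denseSeq α n),
    hc.mono fun _ hy => (iInf_denseSeq_eq_iInf hy).symm⟩

variable [MeasurableSpace α]

lemma iInf_lintegral_comp_eq_lintegral_iInf {ν : Measure β} [SigmaFinite ν]
    {F : β → α → ℝ≥0∞} (hF : ∀ v, Measurable fun y => F y v) (hc : ∀ᵐ y ∂ν, Continuous (F y)) :
    ⨅ (f : β → α) (_ : Measurable f), ∫⁻ y, F y (f y) ∂ν = ∫⁻ y, ⨅ v, F y v ∂ν := by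
  refine le_antisymm (ENNReal.le_of_forall_pos_le_add fun ε hε _ => ?_)
    (le_iInf₂ fun f _ => lintegral_mono fun y => iInf_le _ _)
  obtain ⟨w, hw_pos, hw, hw_lt⟩ :=
    exists_pos_lintegral_lt_of_sigmaFinite ν (ENNReal.coe_ne_zero.2 hε.ne')
  obtain ⟨k, hk, hk_le⟩ := exists_measurable_index_le_iInf_add
    (fun n => hF (denseSeq α n)) hw.coe_nnreal_ennreal (fun y => by simpa using hw_pos y)
  calc ⨅ (f : β → α) (_ : Measurable f), ∫⁻ y, F y (f y) ∂ν
      ≤ ∫⁻ y, F y (denseSeq α (k y)) ∂ν :=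
        iInf₂_le (fun y => denseSeq α (k y)) ((measurable_of_countable _).comp hk)
    _ ≤ ∫⁻ y, ((⨅ v, F y v) + w y) ∂ν := by
        refine lintegral_mono_ae ?_
        filter_upwards [hc] with y hy
        simpa only [iInf_denseSeq_eq_iInf hy] using hk_le y
    _ = ∫⁻ y, ⨅ v, F y v ∂ν + ∫⁻ y, w y ∂ν := lintegral_add_right _ hw.coe_nnreal_ennreal
    _ ≤ ∫⁻ y, ⨅ v, F y v ∂ν + ε := by gcongr

end Interchange

section Translation

variable {G : Type*} [AddCommGroup G] [MeasurableSpace G] [MeasurableSub₂ G] {μ : Measure G}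

lemma measurable_lintegral_withDensity_comp_sub [SFinite μ] {φ : G → ℝ≥0} (hφ : Measurable φ)
    {h : G → ℝ≥0∞} (hh : Measurable h) :
    Measurable fun y => ∫⁻ x, h x ∂(μ.withDensity fun x => φ (y - x)) := by
  have hdens (y : G) : ∫⁻ x, h x ∂(μ.withDensity fun x => φ (y - x)) =
      ∫⁻ x, φ (y - x) * h x ∂μ := lintegral_withDensity_eq_lintegral_mul _ (by fun_prop) hh
  simp only [hdens]
  fun_prop

variable [MeasurableAdd₂ G] {ν : Measure G} [SFinite ν] [ν.IsAddRightInvariant]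

lemma lintegral_lintegral_comp_sub [SFinite μ] {h : G → ℝ≥0∞} (hh : Measurable h) :
    ∫⁻ y, ∫⁻ x, h (y - x) ∂μ ∂ν = μ univ * ∫⁻ u, h u ∂ν := by
  rw [lintegral_lintegral_swap (by fun_prop)]
  simp only [lintegral_sub_right_eq_self h, lintegral_const, mul_comm]

lemma ae_lintegral_comp_sub_ne_top [IsFiniteMeasure μ] {h : G → ℝ≥0∞} (hh : Measurable h)
    (h_int : ∫⁻ u, h u ∂ν ≠ ∞) : ∀ᵐ y ∂ν, ∫⁻ x, h (y - x) ∂μ ≠ ∞ := by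
  refine (ae_lt_top (by fun_prop) ?_).mono fun y hy => hy.ne
  rw [lintegral_lintegral_comp_sub hh]
  finiteness

lemma lintegral_prod_withDensity_comp_add [SFinite μ] {φ : G → ℝ≥0∞} (hφ : Measurable φ)
    [SFinite (ν.withDensity φ)] {g : G → G → ℝ≥0∞} (hg : Measurable (Function.uncurry g)) :
    ∫⁻ w, g w.1 (w.1 + w.2) ∂μ.prod (ν.withDensity φ) =
      ∫⁻ y, ∫⁻ x, g x y ∂(μ.withDensity fun x => φ (y - x)) ∂ν := by
  have hadd : Measurable fun w : G × G => g w.1 (w.1 + w.2) :=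
    hg.comp (measurable_fst.prodMk (measurable_fst.add measurable_snd))
  calc ∫⁻ w, g w.1 (w.1 + w.2) ∂μ.prod (ν.withDensity φ)
      = ∫⁻ x, ∫⁻ u, g x (x + u) ∂ν.withDensity φ ∂μ := lintegral_prod _ hadd.aemeasurable
    _ = ∫⁻ x, ∫⁻ u, φ u * g x (x + u) ∂ν ∂μ := lintegral_congr fun x =>
        lintegral_withDensity_eq_lintegral_mul _ hφ (hadd.comp measurable_prodMk_left)
    _ = ∫⁻ x, ∫⁻ y, φ (y - x) * g x y ∂ν ∂μ := lintegral_congr fun x => by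
        simpa using (lintegral_sub_right_eq_self (fun u => φ u * g x (x + u)) x).symm
    _ = ∫⁻ y, ∫⁻ x, φ (y - x) * g x y ∂μ ∂ν :=
        lintegral_lintegral_swap (by fun_prop)
    _ = ∫⁻ y, ∫⁻ x, g x y ∂(μ.withDensity fun x => φ (y - x)) ∂ν :=
        lintegral_congr fun y => (lintegral_withDensity_eq_lintegral_mul _ (by fun_prop)
          (hg.comp measurable_prodMk_right)).symm

end Translation

section AdditiveNoise

variable {E : Type*} [NormedAddCommGroup E] [MeasurableSpace E] {p : ℝ}

/-- The unnormalised minimum mean `p`-th error of estimating a random vector of law `μ` after adding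
an independent noise of law `ν`. -/
noncomputable def additiveNoiseRisk (p : ℝ) (μ ν : Measure E) : ℝ≥0∞ :=
  ⨅ (f : E → E) (_ : Measurable f), ∫⁻ w, ‖w.1 - f (w.1 + w.2)‖ₑ ^ p ∂μ.prod ν

variable [BorelSpace E] [SecondCountableTopology E]

lemma additiveNoiseRisk_le (p : ℝ) (μ ν : Measure E) [SFinite ν] :
    additiveNoiseRisk p μ ν ≤ μ univ * ∫⁻ u, ‖u‖ₑ ^ p ∂ν := by
  refine (iInf₂_le id measurable_id).trans_eq ?_
  rw [lintegral_prod _ (by fun_prop)]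
  simp [mul_comm]

variable {μ ν : Measure E} [IsFiniteMeasure μ] [SigmaFinite ν] [ν.IsAddRightInvariant]
  {φ : E → ℝ≥0}

lemma ae_continuous_lintegral_enorm_sub_rpow (hp : 0 ≤ p) (hφ : Measurable φ)
    (hφ_int : ∫⁻ u, φ u ∂ν ≠ ∞) (hφ_mom : ∫⁻ u, φ u * ‖u‖ₑ ^ p ∂ν ≠ ∞) :
    ∀ᵐ y ∂ν, Continuous fun v => ∫⁻ x, ‖x - v‖ₑ ^ p ∂(μ.withDensity fun x => φ (y - x)) := by
  filter_upwards [ae_lintegral_comp_sub_ne_top (μ := μ) (by fun_prop) hφ_int,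
    ae_lintegral_comp_sub_ne_top (μ := μ) (by fun_prop) hφ_mom] with y hmass hmoment
  have := isFiniteMeasure_withDensity hmass
  refine continuous_lintegral_enorm_sub_rpow hp (c := y) ?_
  rw [lintegral_withDensity_eq_lintegral_mul _ (by fun_prop) (by fun_prop)]
  simpa only [enorm_sub_rev y, Pi.mul_apply] using hmoment

lemma aemeasurable_minDeviation_withDensity (hp : 0 ≤ p) (hφ : Measurable φ)
    (hφ_int : ∫⁻ u, φ u ∂ν ≠ ∞) (hφ_mom : ∫⁻ u, φ u * ‖u‖ₑ ^ p ∂ν ≠ ∞) :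
    AEMeasurable (fun y => minDeviation p (μ.withDensity fun x => φ (y - x))) ν :=
  aemeasurable_iInf_of_continuous
    (fun v => measurable_lintegral_withDensity_comp_sub hφ (by fun_prop))
    (ae_continuous_lintegral_enorm_sub_rpow hp hφ hφ_int hφ_mom)

lemma additiveNoiseRisk_withDensity (hp : 0 ≤ p) (hφ : Measurable φ)
    (hφ_int : ∫⁻ u, φ u ∂ν ≠ ∞) (hφ_mom : ∫⁻ u, φ u * ‖u‖ₑ ^ p ∂ν ≠ ∞) :
    additiveNoiseRisk p μ (ν.withDensity fun u => φ u) =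
      ∫⁻ y, minDeviation p (μ.withDensity fun x => φ (y - x)) ∂ν :=
  calc additiveNoiseRisk p μ (ν.withDensity fun u => φ u)
      = ⨅ (f : E → E) (_ : Measurable f),
          ∫⁻ y, ∫⁻ x, ‖x - f y‖ₑ ^ p ∂(μ.withDensity fun x => φ (y - x)) ∂ν :=
        iInf_congr fun f => iInf_congr fun hf => lintegral_prod_withDensity_comp_add
          (g := fun x y => ‖x - f y‖ₑ ^ p) (by fun_prop) (by fun_prop)
    _ = ∫⁻ y, minDeviation p (μ.withDensity fun x => φ (y - x)) ∂ν :=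
        iInf_lintegral_comp_eq_lintegral_iInf
          (fun v => measurable_lintegral_withDensity_comp_sub hφ (by fun_prop))
          (ae_continuous_lintegral_enorm_sub_rpow hp hφ hφ_int hφ_mom)

lemma minDeviation_withDensity_comp_sub_le (μ : Measure E) (hφ : Measurable φ) {Φ : E → ℝ≥0}
    (hφΦ : ∀ u, φ u ≤ Φ u) (y : E) :
    minDeviation p (μ.withDensity fun x => φ (y - x)) ≤
      ∫⁻ x, Φ (y - x) * ‖y - x‖ₑ ^ p ∂μ := by
  refine (minDeviation_le p _ y).trans ?_
  rw [lintegral_withDensity_eq_lintegral_mul _ (by fun_prop) (by fun_prop)]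
  refine lintegral_mono fun x => ?_
  rw [Pi.mul_apply, enorm_sub_rev x]
  gcongr
  exact hφΦ (y - x)

lemma continuousAt_additiveNoiseRisk_withDensity (hp : 0 ≤ p) {ι : Type*} [TopologicalSpace ι]
    [FirstCountableTopology ι] {i₀ : ι} {φ : ι → E → ℝ≥0} {Φ : E → ℝ≥0}
    (hφm : ∀ i, Measurable (φ i)) (hφc : ∀ u, ContinuousAt (φ · u) i₀)
    (hφΦ : ∀ᶠ i in 𝓝 i₀, ∀ u, φ i u ≤ Φ u) (hΦm : Measurable Φ)
    (hΦ : ∫⁻ u, Φ u ∂ν ≠ ∞) (hΦp : ∫⁻ u, Φ u * ‖u‖ₑ ^ p ∂ν ≠ ∞) :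
    ContinuousAt (fun i => additiveNoiseRisk p μ (ν.withDensity fun u => φ i u)) i₀ := by
  have hint : ∀ᶠ i in 𝓝 i₀, ∫⁻ u, φ i u ∂ν ≠ ∞ := by
    filter_upwards [hφΦ] with i hi
    refine ne_top_of_le_ne_top hΦ (lintegral_mono fun u => ?_)
    exact ENNReal.coe_le_coe.2 (hi u)
  have hmom : ∀ᶠ i in 𝓝 i₀, ∫⁻ u, φ i u * ‖u‖ₑ ^ p ∂ν ≠ ∞ := by
    filter_upwards [hφΦ] with i hi
    refine ne_top_of_le_ne_top hΦp (lintegral_mono fun u => ?_)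
    gcongr
    exact hi u
  have hrisk : (fun i => ∫⁻ y, minDeviation p (μ.withDensity fun x => φ i (y - x)) ∂ν)
      =ᶠ[𝓝 i₀] fun i => additiveNoiseRisk p μ (ν.withDensity fun u => φ i u) := by
    filter_upwards [hint, hmom] with i hi hi'
    exact (additiveNoiseRisk_withDensity hp (hφm i) hi hi').symm
  refine ContinuousAt.congr ?_ hrisk
  refine tendsto_lintegral_filter_of_dominated_convergence'
    (fun y => ∫⁻ x, Φ (y - x) * ‖y - x‖ₑ ^ p ∂μ) ?_ ?_ ?_ ?_
  · filter_upwards [hint, hmom] with i hi hi'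
    exact aemeasurable_minDeviation_withDensity hp (hφm i) hi hi'
  · filter_upwards [hφΦ] with i hi
    exact .of_forall (minDeviation_withDensity_comp_sub_le μ (hφm i) hi)
  · rw [lintegral_lintegral_comp_sub (h := fun u => Φ u * ‖u‖ₑ ^ p) (by fun_prop)]
    finiteness
  · filter_upwards [ae_lintegral_comp_sub_ne_top (μ := μ) (by fun_prop) hΦ,
      ae_lintegral_comp_sub_ne_top (μ := μ) (by fun_prop) hΦp] with y hy hyp
    refine continuousAt_minDeviation_withDensity hp (c := y) (fun i => by fun_prop)
      (fun x => hφc (y - x)) (hφΦ.mono fun i hi x => hi (y - x)) hy ?_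
    simpa only [enorm_sub_rev y] using hyp

end AdditiveNoise

lemma lintegral_enorm_rpow_ne_top_of_isGaussian {E : Type*} [NormedAddCommGroup E]
    [NormedSpace ℝ E] [CompleteSpace E] [SecondCountableTopology E] [MeasurableSpace E]
    [BorelSpace E] {p : ℝ} (hp : 0 ≤ p) (γ : Measure E) [IsGaussian γ] :
    ∫⁻ u, ‖u‖ₑ ^ p ∂γ ≠ ∞ := by
  have hmem : MemLp id (ENNReal.ofReal p) γ := IsGaussian.memLp_id γ _ ENNReal.ofReal_ne_top
  have hfin := hmem.integrable_norm_rpow'.hasFiniteIntegral.ne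
  simpa only [ENNReal.toReal_ofReal hp, id, Real.enorm_rpow_of_nonneg (norm_nonneg _) hp,
    enorm_norm] using hfin

section PrecisionGaussian

/-- The density of the centred Gaussian distribution with covariance `s⁻¹ • 1`. -/
noncomputable def precisionGaussianPDF (E : Type*) [NormedAddCommGroup E] [InnerProductSpace ℝ E]
    (s : ℝ) (v : E) : ℝ :=
  (s / (2 * Real.pi)) ^ (Module.finrank ℝ E / 2 : ℝ) * Real.exp (-(s / 2) * ‖v‖ ^ 2)

/-- The centred Gaussian distribution with covariance `s⁻¹ • 1`. -/
noncomputable def precisionGaussian (E : Type*) [NormedAddCommGroup E] [InnerProductSpace ℝ E]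
    [FiniteDimensional ℝ E] [MeasurableSpace E] (s : ℝ) : Measure E :=
  (stdGaussian E).map fun z => (√s)⁻¹ • z

variable {E : Type*} [NormedAddCommGroup E] [InnerProductSpace ℝ E] {p : ℝ} {a b s : ℝ}

lemma precisionGaussianPDF_nonneg (hs : 0 ≤ s) (v : E) : 0 ≤ precisionGaussianPDF E s v := by
  unfold precisionGaussianPDF; positivity

@[fun_prop]
lemma continuous_precisionGaussianPDF (s : ℝ) : Continuous (precisionGaussianPDF E s) := by
  unfold precisionGaussianPDF; fun_prop

lemma continuous_precisionGaussianPDF_precision (v : E) :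
    Continuous fun s => precisionGaussianPDF E s v := by
  unfold precisionGaussianPDF
  have hdim : (0 : ℝ) ≤ Module.finrank ℝ E / 2 := by positivity
  fun_prop (disch := exact hdim)

lemma precisionGaussianPDF_le_mul (ha : 0 < a) (has : a ≤ s) (hsb : s ≤ b) (v : E) :
    precisionGaussianPDF E s v ≤
      (b / a) ^ (Module.finrank ℝ E / 2 : ℝ) * precisionGaussianPDF E a v := by
  have hb : 0 < b := ha.trans_le (has.trans hsb)
  have hconst : (b / (2 * Real.pi)) ^ (Module.finrank ℝ E / 2 : ℝ) =
      (b / a) ^ (Module.finrank ℝ E / 2 : ℝ) *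
        (a / (2 * Real.pi)) ^ (Module.finrank ℝ E / 2 : ℝ) := by
    rw [← Real.mul_rpow (by positivity) (by positivity)]
    field_simp
  calc precisionGaussianPDF E s v
      ≤ (b / (2 * Real.pi)) ^ (Module.finrank ℝ E / 2 : ℝ) * Real.exp (-(a / 2) * ‖v‖ ^ 2) := by
        have hs : 0 ≤ s := ha.le.trans has
        unfold precisionGaussianPDF
        gcongr
    _ = (b / a) ^ (Module.finrank ℝ E / 2 : ℝ) * precisionGaussianPDF E a v := by
        rw [hconst, mul_assoc, precisionGaussianPDF]

variable [FiniteDimensional ℝ E] [MeasurableSpace E] [BorelSpace E]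

instance isGaussian_precisionGaussian (s : ℝ) : IsGaussian (precisionGaussian E s) :=
  isGaussian_map ((√s)⁻¹ • ContinuousLinearMap.id ℝ E)

lemma charFun_precisionGaussian (hs : 0 < s) (t : E) :
    charFun (precisionGaussian E s) t = Complex.exp (-(‖t‖ ^ 2 / (2 * s) : ℝ)) := by
  rw [precisionGaussian, charFun_map_smul, charFun_stdGaussian, norm_smul, norm_inv,
    Real.norm_of_nonneg (Real.sqrt_nonneg s)]
  congr 1
  rw [← Complex.ofReal_pow, mul_pow, inv_pow, Real.sq_sqrt hs.le]
  push_cast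
  field_simp

lemma div_two_pi_rpow_mul_pi_div_rpow (hs : 0 < s) (d : ℝ) :
    (s / (2 * Real.pi)) ^ d * (Real.pi / (s / 2)) ^ d = 1 := by
  have hone : s / (2 * Real.pi) * (Real.pi / (s / 2)) = 1 := by field_simp
  rw [← Real.mul_rpow (by positivity) (by positivity), hone, Real.one_rpow]

lemma integral_precisionGaussianPDF (hs : 0 < s) : ∫ v, precisionGaussianPDF E s v = 1 := by
  simp only [precisionGaussianPDF]
  rw [integral_const_mul, GaussianFourier.integral_rexp_neg_mul_sq_norm (by positivity),
    div_two_pi_rpow_mul_pi_div_rpow hs]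

lemma lintegral_precisionGaussianPDF (hs : 0 < s) :
    ∫⁻ v, ENNReal.ofReal (precisionGaussianPDF E s v) = 1 := by
  have hint : Integrable (precisionGaussianPDF E s) :=
    .of_integral_ne_zero (by rw [integral_precisionGaussianPDF hs]; exact one_ne_zero)
  rw [← ofReal_integral_eq_lintegral_ofReal hint
    (.of_forall fun v => precisionGaussianPDF_nonneg hs.le v), integral_precisionGaussianPDF hs,
    ENNReal.ofReal_one]

lemma integral_precisionGaussianPDF_mul_cexp (hs : 0 < s) (t : E) :
    ∫ v, (precisionGaussianPDF E s v : ℂ) * Complex.exp ((inner ℝ v t : ℝ) * Complex.I) =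
      Complex.exp (-(‖t‖ ^ 2 / (2 * s) : ℝ)) := by
  have hre : 0 < ((s / 2 : ℝ) : ℂ).re := by rw [Complex.ofReal_re]; positivity
  have hsplit (v : E) :
      (precisionGaussianPDF E s v : ℂ) * Complex.exp ((inner ℝ v t : ℝ) * Complex.I) =
      (((s / (2 * Real.pi)) ^ (Module.finrank ℝ E / 2 : ℝ) : ℝ) : ℂ) *
        Complex.exp (-((s / 2 : ℝ) : ℂ) * ‖v‖ ^ 2 + Complex.I * (inner ℝ t v : ℝ)) := by
    rw [precisionGaussianPDF, Complex.exp_add, real_inner_comm v t, mul_comm Complex.I]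
    push_cast
    ring
  have hpow : ((Real.pi : ℂ) / ((s / 2 : ℝ) : ℂ)) ^ ((Module.finrank ℝ E : ℂ) / 2) =
      (((Real.pi / (s / 2)) ^ (Module.finrank ℝ E / 2 : ℝ) : ℝ) : ℂ) := by
    rw [Complex.ofReal_cpow (by positivity)]
    push_cast
    rfl
  simp only [hsplit]
  rw [integral_const_mul, GaussianFourier.integral_cexp_neg_mul_sq_norm_add hre, ← mul_assoc, hpow,
    ← Complex.ofReal_mul, div_two_pi_rpow_mul_pi_div_rpow hs, Complex.ofReal_one, one_mul,
    Complex.I_sq]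
  congr 1
  push_cast
  field_simp
  norm_num

lemma precisionGaussian_eq_withDensity (hs : 0 < s) :
    precisionGaussian E s =
      volume.withDensity fun v => ENNReal.ofReal (precisionGaussianPDF E s v) := by
  have : IsFiniteMeasure
      (volume.withDensity fun v : E => ENNReal.ofReal (precisionGaussianPDF E s v)) :=
    isFiniteMeasure_withDensity (by simp [lintegral_precisionGaussianPDF hs])
  refine Measure.ext_of_charFun (funext fun t => ?_)
  rw [charFun_precisionGaussian hs, charFun_apply,
    integral_withDensity_eq_integral_toReal_smul (by fun_prop) (by simp),
    ← integral_precisionGaussianPDF_mul_cexp hs]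
  simp only [ENNReal.toReal_ofReal (precisionGaussianPDF_nonneg hs.le _), Complex.real_smul]

lemma lintegral_mul_precisionGaussianPDF (hs : 0 < s) (C : ℝ≥0) {h : E → ℝ≥0∞}
    (hh : Measurable h) :
    ∫⁻ u, ↑(C * (precisionGaussianPDF E s u).toNNReal) * h u =
      C * ∫⁻ u, h u ∂precisionGaussian E s := by
  rw [precisionGaussian_eq_withDensity hs,
    lintegral_withDensity_eq_lintegral_mul _ (by fun_prop) hh,
    ← lintegral_const_mul' _ _ ENNReal.coe_ne_top]
  simp only [ENNReal.coe_mul, mul_assoc]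
  rfl

lemma continuousAt_additiveNoiseRisk_precisionGaussian (hp : 0 ≤ p) (μ : Measure E)
    [IsFiniteMeasure μ] (hs : 0 < s) :
    ContinuousAt (fun t => additiveNoiseRisk p μ (precisionGaussian E t)) s := by
  set C : ℝ≥0 := (((2 * s) / (s / 2)) ^ (Module.finrank ℝ E / 2 : ℝ)).toNNReal
  have hdom : ∀ᶠ t in 𝓝 s, ∀ u : E, (precisionGaussianPDF E t u).toNNReal ≤
      C * (precisionGaussianPDF E (s / 2) u).toNNReal := by
    filter_upwards [Icc_mem_nhds (show s / 2 < s by linarith) (show s < 2 * s by linarith)]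
      with t ht u
    rw [← Real.toNNReal_mul (by positivity)]
    exact Real.toNNReal_le_toNNReal (precisionGaussianPDF_le_mul (by positivity) ht.1 ht.2 u)
  have hdens : (fun t => additiveNoiseRisk p μ (volume.withDensity fun u : E =>
      ((precisionGaussianPDF E t u).toNNReal : ℝ≥0∞))) =ᶠ[𝓝 s]
      fun t => additiveNoiseRisk p μ (precisionGaussian E t) := by
    filter_upwards [lt_mem_nhds hs] with t ht
    rw [precisionGaussian_eq_withDensity ht]
    rfl
  refine (continuousAt_additiveNoiseRisk_withDensity hp (fun t => by fun_prop)
    (fun u => ?_) hdom (by fun_prop) ?_ ?_).congr hdens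
  · exact (continuous_real_toNNReal.comp
      (continuous_precisionGaussianPDF_precision u)).continuousAt
  · have hmass := lintegral_mul_precisionGaussianPDF (E := E) (half_pos hs) C measurable_one
    simp only [Pi.one_apply, mul_one, lintegral_one] at hmass
    rw [hmass]
    finiteness
  · rw [lintegral_mul_precisionGaussianPDF (half_pos hs) C (by fun_prop)]
    exact ENNReal.mul_ne_top ENNReal.coe_ne_top (lintegral_enorm_rpow_ne_top_of_isGaussian hp _)

end PrecisionGaussian

section Channel

variable {Ω : Type*} [MeasurableSpace Ω] {P : Measure Ω} {n : ℕ}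
  {X N Z : Ω → EuclideanSpace ℝ (Fin n)} {p : ℝ}

lemma pthError_eq_lintegral_enorm (P : Measure Ω) (X V : Ω → EuclideanSpace ℝ (Fin n))
    (hp : 0 ≤ p) : pthError P X V p = (n : ℝ≥0∞)⁻¹ * ∫⁻ ω, ‖X ω - V ω‖ₑ ^ p ∂P := by
  rw [pthError]
  congr 1
  refine lintegral_congr fun ω => ?_
  rw [sqErr_eq_norm_sq, ← Real.rpow_two, ← Real.rpow_mul (norm_nonneg _),
    mul_div_cancel₀ _ two_ne_zero, ← ENNReal.ofReal_rpow_of_nonneg (norm_nonneg _) hp,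
    ofReal_norm]

lemma mmpe_le_mmpe_comp (P : Measure Ω) (X Y : Ω → EuclideanSpace ℝ (Fin n)) (p : ℝ)
    {h : EuclideanSpace ℝ (Fin n) → EuclideanSpace ℝ (Fin n)} (hh : Measurable h) :
    mmpe P X Y p ≤ mmpe P X (fun ω => h (Y ω)) p :=
  le_iInf₂ fun f hf => iInf₂_le (fun y => f (h y)) (hf.comp hh)

lemma mmpe_const_smul (P : Measure Ω) (X Y : Ω → EuclideanSpace ℝ (Fin n)) (p : ℝ)
    {c : ℝ} (hc : c ≠ 0) : mmpe P X (fun ω => c • Y ω) p = mmpe P X Y p := by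
  refine le_antisymm ?_ (mmpe_le_mmpe_comp P X Y p (measurable_const_smul c))
  simpa only [inv_smul_smul₀ hc] using
    mmpe_le_mmpe_comp P X (fun ω => c • Y ω) p (measurable_const_smul c⁻¹)

lemma mmpe_add_eq_additiveNoiseRisk [IsFiniteMeasure P] (hX : AEMeasurable X P)
    (hN : AEMeasurable N P) (hXN : IndepFun X N P) (hn : n ≠ 0) (hp : 0 ≤ p) :
    mmpe P X (fun ω => X ω + N ω) p =
      (n : ℝ≥0∞)⁻¹ * additiveNoiseRisk p (P.map X) (P.map N) := by
  have hn₀ : (n : ℝ≥0∞)⁻¹ ≠ 0 := ENNReal.inv_ne_zero.2 (ENNReal.natCast_ne_top n)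
  have hn_top : (n : ℝ≥0∞)⁻¹ ≠ ∞ := ENNReal.inv_ne_top.2 (Nat.cast_ne_zero.2 hn)
  simp only [mmpe, additiveNoiseRisk, ENNReal.mul_iInf_of_ne hn₀ hn_top]
  refine iInf_congr fun f => iInf_congr fun hf => ?_
  rw [pthError_eq_lintegral_enorm P _ _ hp,
    ← (indepFun_iff_map_prod_eq_prod_map_map hX hN).1 hXN,
    lintegral_map' (by fun_prop) (hX.prodMk hN)]

lemma mmpe_channelOutput [IsFiniteMeasure P] (hX : AEMeasurable X P)
    (hZ : HasLaw Z (stdGaussian (EuclideanSpace ℝ (Fin n))) P) (hXZ : IndepFun X Z P) (hn : n ≠ 0)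
    (hp : 0 ≤ p) {s : ℝ} (hs : 0 < s) :
    mmpe P X (channelOutput X Z s) p =
      (n : ℝ≥0∞)⁻¹ * additiveNoiseRisk p (P.map X) (precisionGaussian _ s) := by
  have hsqrt : √s ≠ 0 := (Real.sqrt_pos.2 hs).ne'
  have hlaw : P.map (fun ω => (√s)⁻¹ • Z ω) = precisionGaussian _ s := by
    rw [precisionGaussian, ← hZ.map_eq, AEMeasurable.map_map_of_aemeasurable (by fun_prop)
      hZ.aemeasurable]
    rfl
  have hscale : channelOutput X Z s = fun ω => √s • (X ω + (√s)⁻¹ • Z ω) := by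
    funext ω
    rw [channelOutput, smul_add, smul_inv_smul₀ hsqrt]
  rw [hscale, mmpe_const_smul _ _ _ _ hsqrt, ← hlaw]
  exact mmpe_add_eq_additiveNoiseRisk hX (hZ.aemeasurable.const_smul (√s)⁻¹)
    (hXZ.comp measurable_id (measurable_const_smul _)) hn hp

end Channel

theorem mainTheorem7 {Ω : Type*} [MeasurableSpace Ω] (P : Measure Ω) [IsProbabilityMeasure P]
    (n : ℕ) (hn : 0 < n) (X Z : Ω → EuclideanSpace ℝ (Fin n))
    (hX : AEMeasurable X P)
    (hZ : HasLaw Z (stdGaussian (EuclideanSpace ℝ (Fin n))) P)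
    (hXZ : IndepFun X Z P) (p : ℝ) (hp : 0 ≤ p) :
    (∀ snr : ℝ, 0 < snr → mmpe P X (channelOutput X Z snr) p < ∞) ∧
      ContinuousOn (fun snr : ℝ => (mmpe P X (channelOutput X Z snr) p).toReal) (Ioi 0) := by
  have hn_top : (n : ℝ≥0∞)⁻¹ ≠ ∞ := ENNReal.inv_ne_top.2 (Nat.cast_ne_zero.2 hn.ne')
  have hrisk : EqOn (fun snr => mmpe P X (channelOutput X Z snr) p)
      (fun snr => (n : ℝ≥0∞)⁻¹ * additiveNoiseRisk p (P.map X) (precisionGaussian _ snr))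
      (Ioi 0) := fun snr hsnr => mmpe_channelOutput hX hZ hXZ hn.ne' hp hsnr
  have hfin (snr : ℝ) (hsnr : 0 < snr) : mmpe P X (channelOutput X Z snr) p < ∞ := by
    refine (hrisk hsnr).trans_lt (ENNReal.mul_lt_top hn_top.lt_top ?_)
    exact (additiveNoiseRisk_le p _ _).trans_lt (ENNReal.mul_lt_top (measure_lt_top _ _)
      (lintegral_enorm_rpow_ne_top_of_isGaussian hp _).lt_top)
  have hcont : ContinuousOn (fun snr => mmpe P X (channelOutput X Z snr) p) (Ioi 0) :=
    .congr (fun snr hsnr => (ENNReal.Tendsto.const_mul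
      (continuousAt_additiveNoiseRisk_precisionGaussian hp _ hsnr) (.inr hn_top)).mono_left
        nhdsWithin_le_nhds) hrisk
  exact ⟨hfin, ENNReal.continuousOn_toReal.comp hcont fun snr hsnr => (hfin snr hsnr).ne⟩
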